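/- All Hilbert spaces are finite-dimensional and complex. A quantum state is a positive semidefinite operator of unit trace; a quantum channel $\mathcal A\colon\mathcal L(\mathcal H_A)\to\mathcal L(\mathcal H_B)$ is a linear, completely positive, trace-preserving map. For states $\rho,\sigma$ let $T(\rho,\sigma)=\tfrac12\|\rho-\sigma\|_1$, where $\|B\|_1=\operatorname{Tr}\sqrt{B^\dagger B}$, and let $$D(\rho\|\sigma)=\begin{cases}\operatorname{Tr}[\rho(\log\rho-\log\sigma)] & \text{if } \operatorname{supp}(\rho)\subseteq\operatorname{supp}(\sigma),\\ +\infty & \text{otherwise,}\end{cases}$$ with the natural logarithm, where the support of an operator is the orthogonal complement of its kernel and logarithms are taken on the support. For $\varepsilon\ge 0$, a channel $\mathcal A$ is $\varepsilon$-QLDP (quantum locally differentially private) if $\operatorname{Tr}[M\mathcal A(\rho)]\le e^{\varepsilon}\operatorname{Tr}[M\mathcal A(\sigma)]$ for all states $\rho,\sigma$ on $\mathcal H_A$ and all operators $M$ on $\mathcal H_B$ with $0\le M\le I$. Proposition (Contraction of Quantum Relative Entropy under Local Privacy). Let $\varepsilon\ge 0$, let $\mathcal A$ be an $\varepsilon$-QLDP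 channel, and let $\rho,\sigma$ be states on $\mathcal H_A$. Then $$D(\mathcal A(\rho)\|\mathcal A(\sigma))\le \varepsilon\left(\frac{e^{\varepsilon}-1}{e^{\varepsilon}+1}\right)T(\rho,\sigma).$$ -/

import Mathlib

open scoped ComplexOrder MatrixOrder Matrix.Norms.L2Operator Matrix

noncomputable section

namespace QuantumPrivacy

/-! A finite-dimensional quantum system with an orthonormal basis indexed by the finite type `n` is
the Hilbert space `EuclideanSpace ℂ n`; its linear operators are the matrices `Matrix n n ℂ`. -/

variable {m n : Type*} [Fintype m] [DecidableEq m] [Fintype n] [DecidableEq n]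

/-- A quantum state: a positive semidefinite operator of unit trace. -/
structure IsState (ρ : Matrix n n ℂ) : Prop where
  posSemidef : ρ.PosSemidef
  trace_eq_one : ρ.trace = 1

variable (m n) in
/-- A quantum channel: a linear, completely positive and trace-preserving map on operators. -/
structure QuantumChannel extends CompletelyPositiveMap (Matrix m m ℂ) (Matrix n n ℂ) where
  trace_map (X : Matrix m m ℂ) : (toLinearMap X).trace = X.trace

instance : CoeFun (QuantumChannel m n) (fun _ => Matrix m m ℂ → Matrix n n ℂ) where
  coe A := A.toLinearMap

/-- The trace norm `‖B‖₁ = Tr √(B† B)`. -/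
def traceNorm (B : Matrix n n ℂ) : ℝ := (CFC.sqrt (Bᴴ * B)).trace.re

/-- The normalized trace distance `T(ρ, σ) = ‖ρ - σ‖₁ / 2`. -/
def traceDistance (ρ σ : Matrix n n ℂ) : ℝ := 1 / 2 * traceNorm (ρ - σ)

/-- The support of an operator: the orthogonal complement of its kernel. -/
def supp (X : Matrix n n ℂ) : Submodule ℂ (EuclideanSpace ℂ n) :=
  (LinearMap.ker (Matrix.toEuclideanLin X))ᗮ

open Classical in
/-- The (Umegaki) quantum relative entropy, with the natural logarithm. As `Real.log 0 = 0`, the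
operator `CFC.log X` is the logarithm of `X` on its support and zero on its kernel, which is the
usual convention `0 log 0 = 0` (and makes no difference for `σ`, as `ρ` vanishes on its kernel
in the first case). -/
def relativeEntropy (ρ σ : Matrix n n ℂ) : EReal :=
  if supp ρ ≤ supp σ then (((ρ * (CFC.log ρ - CFC.log σ)).trace.re : ℝ) : EReal) else ⊤

/-- `(ε, δ)`-quantum local differential privacy: `Tr[M A(ρ)] ≤ e^ε Tr[M A(σ)] + δ` for all states
`ρ`, `σ` and all `0 ≤ M ≤ I` in the Loewner order (all these traces are real). -/
def IsLocallyPrivate (ε δ : ℝ) (A : QuantumChannel m n) : Prop :=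
  ∀ ρ σ : Matrix m m ℂ, IsState ρ → IsState σ → ∀ M : Matrix n n ℂ, 0 ≤ M → M ≤ 1 →
    (M * A ρ).trace.re ≤ Real.exp ε * (M * A σ).trace.re + δ

/-- `ε`-QLDP is `(ε, 0)`-QLDP. -/
def IsQLDP (ε : ℝ) (A : QuantumChannel m n) : Prop := IsLocallyPrivate ε 0 A

end QuantumPrivacy

end

namespace QuantumPrivacy

variable {m n : Type*} [Fintype m] [DecidableEq m] [Fintype n] [DecidableEq n]

/-! Put `P = A ρ`, `Q = A σ`, `a = exp ε`. Privacy gives `P ≤ a • Q` and `Q ≤ a • P`. Applied to the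
positive and negative parts of `ρ - σ`, it also bounds Tr[(P - Q)L] by K(c₂ - c₁) whenever c₁ ≤ L ≤
c₂, where K = (a - 1)/(a + 1) · T(ρ, σ).

On the segment R(s) = (1 - s)Q + sP, D(P‖Q) is the integral over [0, 1] of Tr[(P - Q)(log R(s) - log
Q)]. Operator monotonicity of log puts log R(s) - log Q between log(1 + s(a⁻¹ - 1)) and log(1 + s(a
- 1)), so the integrand is at most K times the difference of these logarithms, which integrates to
exactly log a = ε.

Klein's inequality and Riemann sums replace differentiation under the trace. Singular P, Q are
reached by adding δI and letting δ → 0. -/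

/-! ### Spectral double sums and Klein's inequality -/

/-- The joint distribution of the eigenvalues of two Hermitian matrices (Nussbaum-Szkoła). -/
theorem exists_weights_trace_cfc_mul_cfc {X Y : Matrix n n ℂ} (hX : X.IsHermitian)
    (hY : Y.IsHermitian) : ∃ w : n → n → ℝ, (∀ i j, 0 ≤ w i j) ∧ ∀ f g : ℝ → ℝ,
      (cfc f X * cfc g Y).trace.re =
        ∑ i, ∑ j, w i j * (f (hX.eigenvalues i) * g (hY.eigenvalues j)) := by
  set U : Matrix n n ℂ := hX.eigenvectorUnitary.1
  set V : Matrix n n ℂ := hY.eigenvectorUnitary.1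
  -- The weights are the squared overlaps of the two eigenbases.
  refine ⟨fun i j => Complex.normSq ((Uᴴ * V) i j), fun i j => Complex.normSq_nonneg _,
    fun f g => ?_⟩
  rw [hX.cfc_eq, hY.cfc_eq, Matrix.IsHermitian.cfc, Matrix.IsHermitian.cfc,
    Unitary.conjStarAlgAut_apply, Unitary.conjStarAlgAut_apply]
  set D : Matrix n n ℂ := Matrix.diagonal (RCLike.ofReal ∘ f ∘ hX.eigenvalues) with hD
  set E : Matrix n n ℂ := Matrix.diagonal (RCLike.ofReal ∘ g ∘ hY.eigenvalues) with hE
  have h : (U * D * star U * (V * E * star V)).trace =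
      (D * (Uᴴ * V) * (E * (Uᴴ * V)ᴴ)).trace := by
    rw [Matrix.conjTranspose_mul, Matrix.conjTranspose_conjTranspose, Matrix.star_eq_conjTranspose,
      Matrix.star_eq_conjTranspose, ← Matrix.mul_assoc E, ← Matrix.mul_assoc _ _ U,
      Matrix.trace_mul_comm _ U]
    simp only [Matrix.mul_assoc]
  rw [h]
  generalize Uᴴ * V = W
  rw [Matrix.trace, Complex.re_sum]
  refine Finset.sum_congr rfl fun i _ => ?_
  rw [Matrix.diag_apply, Matrix.mul_apply, Complex.re_sum]
  refine Finset.sum_congr rfl fun j _ => ?_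
  rw [hD, hE, Matrix.diagonal_mul, Matrix.diagonal_mul, Matrix.conjTranspose_apply]
  beta_reduce
  generalize W i j = z
  have hz : z * star z = (Complex.normSq z : ℂ) := Complex.mul_conj z
  calc _ = ((f (hX.eigenvalues i) : ℂ) * (g (hY.eigenvalues j) : ℂ) * (z * star z)).re := by
        simp only [Function.comp_apply, RCLike.ofReal_eq_complex_ofReal]; ring_nf
    _ = _ := by rw [hz]; norm_cast; ring

theorem continuousOn_spectrum (f : ℝ → ℝ) (X : Matrix n n ℂ) :
    ContinuousOn f (spectrum ℝ X) := X.finite_real_spectrum.continuousOn f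

theorem add_smul_one_eq_cfc {X : Matrix n n ℂ} (hX : X.IsHermitian) (δ : ℝ) :
    X + δ • (1 : Matrix n n ℂ) = cfc (fun x : ℝ => x + δ) X := by
  have hX' : IsSelfAdjoint X := hX
  rw [cfc_add (a := X) (fun x : ℝ => x) (fun _ => δ), cfc_id' ℝ X, cfc_const δ X,
    Algebra.algebraMap_eq_smul_one]

theorem log_add_smul_one_eq_cfc {X : Matrix n n ℂ} (hX : X.IsHermitian) (δ : ℝ) :
    CFC.log (X + δ • (1 : Matrix n n ℂ)) = cfc (fun x : ℝ => Real.log (x + δ)) X := by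
  have hX' : IsSelfAdjoint X := hX
  rw [add_smul_one_eq_cfc hX, CFC.log]
  exact (cfc_comp' Real.log (fun x : ℝ => x + δ) X
    ((X.finite_real_spectrum.image _).continuousOn _)).symm

/-- The relative entropy as a classical one, for matrices shifted by a multiple of the identity. -/
theorem exists_weights_trace_mul_log_sub_log {X Y : Matrix n n ℂ} (hX : X.IsHermitian)
    (hY : Y.IsHermitian) : ∃ w : n → n → ℝ, (∀ i j, 0 ≤ w i j) ∧
      (∀ f g : ℝ → ℝ, (cfc f X * cfc g Y).trace.re =
        ∑ i, ∑ j, w i j * (f (hX.eigenvalues i) * g (hY.eigenvalues j))) ∧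
      ∀ δ : ℝ, ((X + δ • (1 : Matrix n n ℂ)) *
          (CFC.log (X + δ • (1 : Matrix n n ℂ)) - CFC.log (Y + δ • (1 : Matrix n n ℂ)))).trace.re =
        ∑ i, ∑ j, w i j * ((hX.eigenvalues i + δ) *
          (Real.log (hX.eigenvalues i + δ) - Real.log (hY.eigenvalues j + δ))) := by
  obtain ⟨w, hw, h⟩ := exists_weights_trace_cfc_mul_cfc hX hY
  refine ⟨w, hw, h, fun δ => ?_⟩
  have hY' : IsSelfAdjoint Y := hY
  rw [log_add_smul_one_eq_cfc hX, log_add_smul_one_eq_cfc hY, add_smul_one_eq_cfc hX, mul_sub,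
    Matrix.trace_sub, Complex.sub_re, h,
    ← cfc_mul _ _ X (continuousOn_spectrum _ _) (continuousOn_spectrum _ _)]
  have h1 := h (fun x => (x + δ) * Real.log (x + δ)) (fun _ => 1)
  rw [cfc_const_one ℝ Y, mul_one] at h1
  rw [h1, ← Finset.sum_sub_distrib]
  refine Finset.sum_congr rfl fun i _ => ?_
  rw [← Finset.sum_sub_distrib]
  exact Finset.sum_congr rfl fun j _ => by ring

theorem sub_le_mul_log_sub_log {x y : ℝ} (hx : 0 < x) (hy : 0 < y) :
    x - y ≤ x * (Real.log x - Real.log y) := by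
  have h := Real.log_le_sub_one_of_pos (div_pos hy hx)
  rw [Real.log_div hy.ne' hx.ne'] at h
  have h2 := mul_le_mul_of_nonneg_left h hx.le
  have h3 : x * (y / x - 1) = y - x := by field_simp
  linarith

/-- Klein's inequality for the relative entropy. -/
theorem trace_sub_le_trace_mul_log_sub_log {X Y : Matrix n n ℂ} (hX : X.PosDef) (hY : Y.PosDef) :
    (X - Y).trace.re ≤ (X * (CFC.log X - CFC.log Y)).trace.re := by
  obtain ⟨w, hw, h, hlog⟩ := exists_weights_trace_mul_log_sub_log hX.isHermitian hY.isHermitian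
  have hX' : IsSelfAdjoint X := hX.isHermitian
  have hY' : IsSelfAdjoint Y := hY.isHermitian
  have h0 := hlog 0
  simp only [zero_smul, add_zero] at h0
  have h1 := h (fun x => x) (fun _ => 1)
  have h2 := h (fun _ => 1) (fun x => x)
  rw [cfc_const_one ℝ Y, mul_one, cfc_id' ℝ X] at h1
  rw [cfc_const_one ℝ X, one_mul, cfc_id' ℝ Y] at h2
  rw [h0, Matrix.trace_sub, Complex.sub_re, h1, h2, ← Finset.sum_sub_distrib]
  refine Finset.sum_le_sum fun i _ => ?_
  rw [← Finset.sum_sub_distrib]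
  refine Finset.sum_le_sum fun j _ => ?_
  rw [← mul_sub, mul_one, one_mul]
  exact mul_le_mul_of_nonneg_left
    (sub_le_mul_log_sub_log (hX.eigenvalues_pos i) (hY.eigenvalues_pos j)) (hw i j)

/-! ### Integration along the segment from `Q` to `P` -/

/-- A mean-value comparison without derivatives or continuity: on a uniform mesh, the gap between
right and left Riemann sums of `φ` telescopes to (φ(1) - φ(0))/(N + 1). -/
theorem sub_le_sub_of_forall_sub_le {G g φ : ℝ → ℝ}
    (hG : ∀ s t, 0 ≤ s → s < t → t ≤ 1 → G t - G s ≤ (t - s) * φ t)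
    (hg : ∀ s t, 0 ≤ s → s < t → t ≤ 1 → (t - s) * φ s ≤ g t - g s) :
    G 1 - G 0 ≤ g 1 - g 0 := by
  have key (N : ℕ) : G 1 - G 0 ≤ g 1 - g 0 + (φ 1 - φ 0) * (1 / ((N : ℝ) + 1)) := by
    have hN : (0 : ℝ) < N + 1 := by positivity
    have step (k : ℕ) (hk : k ≤ N + 1) : G (k / ((N : ℝ) + 1)) - G 0 ≤
        g (k / ((N : ℝ) + 1)) - g 0 + (φ (k / ((N : ℝ) + 1)) - φ 0) * (1 / ((N : ℝ) + 1)) := by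
      induction k with
      | zero => simp
      | succ k ih =>
        have ih := ih (by omega)
        have hs : (0 : ℝ) ≤ k / ((N : ℝ) + 1) := by positivity
        have hst : ((k + 1 : ℕ) : ℝ) / ((N : ℝ) + 1) - k / ((N : ℝ) + 1) = 1 / ((N : ℝ) + 1) := by
          push_cast; ring
        have hpos : 0 < 1 / ((N : ℝ) + 1) := by positivity
        have ht : ((k + 1 : ℕ) : ℝ) / ((N : ℝ) + 1) ≤ 1 := by
          rw [div_le_one hN]; exact_mod_cast hk
        have h1 := hG _ _ hs (by linarith) ht
        have h2 := hg _ _ hs (by linarith) ht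
        rw [hst] at h1 h2
        linarith
    have := step (N + 1) le_rfl
    rwa [Nat.cast_add, Nat.cast_one, div_self hN.ne'] at this
  have hlim : Filter.Tendsto (fun N : ℕ => g 1 - g 0 + (φ 1 - φ 0) * (1 / ((N : ℝ) + 1)))
      Filter.atTop (nhds (g 1 - g 0 + 0)) := by
    refine tendsto_const_nhds.add ?_
    simpa only [mul_zero] using
      tendsto_one_div_add_atTop_nhds_zero_nat.const_mul (φ 1 - φ 0)
  rw [add_zero] at hlim
  exact ge_of_tendsto' hlim key

theorem log_smul_one_le_log_sub_log {c : ℝ} (hc : 0 < c) {X Y : Matrix n n ℂ} (hX : X.PosDef)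
    (h : c • X ≤ Y) : Real.log c • (1 : Matrix n n ℂ) ≤ CFC.log Y - CFC.log X := by
  have hX' : IsStrictlyPositive X := hX.isStrictlyPositive
  have hcX : IsStrictlyPositive (c • X) := (hX.smul hc).isStrictlyPositive
  have h1 := CFC.log_le_log h hcX
  rw [CFC.log_smul' X hc hX', Algebra.algebraMap_eq_smul_one] at h1
  exact le_sub_iff_add_le.mpr h1

theorem log_sub_log_le_log_smul_one {c : ℝ} (hc : 0 < c) {X Y : Matrix n n ℂ} (hX : X.PosDef)
    (hY : Y.PosDef) (h : Y ≤ c • X) :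
    CFC.log Y - CFC.log X ≤ Real.log c • (1 : Matrix n n ℂ) := by
  have hX' : IsStrictlyPositive X := hX.isStrictlyPositive
  have h1 := CFC.log_le_log h hY.isStrictlyPositive
  rw [CFC.log_smul' X hc hX', Algebra.algebraMap_eq_smul_one] at h1
  exact sub_le_iff_le_add.mpr h1

/-- Tangent-line inequality for the convex function u log u - u at u = 1 + sc. -/
theorem mul_log_le_sub_primitive (c : ℝ) {s t : ℝ} (hs : 0 < 1 + s * c) (ht : 0 < 1 + t * c) :
    (t - s) * (c * Real.log (1 + s * c)) ≤
      ((1 + t * c) * Real.log (1 + t * c) - (1 + t * c)) -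
        ((1 + s * c) * Real.log (1 + s * c) - (1 + s * c)) := by
  have := sub_le_mul_log_sub_log ht hs
  linarith

/-- An upper bound on the relative entropy of positive definite matrices with bounded ratio. -/
theorem trace_mul_log_sub_log_le_of_posDef {a K : ℝ} (ha : 1 < a) (hK : 0 ≤ K)
    {P Q : Matrix n n ℂ} (hP : P.PosDef) (hQ : Q.PosDef) (htr : P.trace.re = Q.trace.re)
    (hPQ : P ≤ a • Q) (hQP : Q ≤ a • P)
    (hd : ∀ (L : Matrix n n ℂ) (c₁ c₂ : ℝ), c₁ • (1 : Matrix n n ℂ) ≤ L →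
      L ≤ c₂ • (1 : Matrix n n ℂ) → ((P - Q) * L).trace.re ≤ K * (c₂ - c₁)) :
    (P * (CFC.log P - CFC.log Q)).trace.re ≤ Real.log a * K := by
  have ha0 : 0 < a := by linarith
  have hai : a⁻¹ < 1 := inv_lt_one_of_one_lt₀ ha
  have hai0 : 0 < a⁻¹ := inv_pos.mpr ha0
  have hPQ' : a⁻¹ • Q ≤ P := by
    have := smul_le_smul_of_nonneg_left hQP hai0.le
    rwa [smul_smul, inv_mul_cancel₀ ha0.ne', one_smul] at this
  let R : ℝ → Matrix n n ℂ := fun s => (1 - s) • Q + s • P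
  have hR (s : ℝ) (h0 : 0 ≤ s) (h1 : s ≤ 1) : (R s).PosDef := by
    rcases h0.eq_or_lt with rfl | h0
    · simpa [R] using hQ
    · have h := (hP.smul h0).posSemidef_add (hQ.posSemidef.smul (sub_nonneg.mpr h1))
      exact h
  have hRsub (s t : ℝ) : R t - R s = (t - s) • (P - Q) := by
    simp only [R]; module
  have hup (s : ℝ) (h0 : 0 ≤ s) : R s ≤ (1 + s * (a - 1)) • Q := by
    have := smul_le_smul_of_nonneg_left hPQ h0
    calc R s ≤ (1 - s) • Q + s • (a • Q) := add_le_add_right this _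
      _ = _ := by module
  have hlow (s : ℝ) (h0 : 0 ≤ s) : (1 + s * (a⁻¹ - 1)) • Q ≤ R s := by
    have := smul_le_smul_of_nonneg_left hPQ' h0
    calc _ = (1 - s) • Q + s • (a⁻¹ • Q) := by module
      _ ≤ R s := add_le_add_right this _
  have hpu (s : ℝ) (h0 : 0 ≤ s) : 0 < 1 + s * (a - 1) := by nlinarith
  have hpl (s : ℝ) (h0 : 0 ≤ s) (h1 : s ≤ 1) : 0 < 1 + s * (a⁻¹ - 1) := by nlinarith
  let φ : ℝ → ℝ := fun s => K * (Real.log (1 + s * (a - 1)) - Real.log (1 + s * (a⁻¹ - 1)))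
  let ψ : ℝ → ℝ → ℝ := fun c s => (1 + s * c) * Real.log (1 + s * c) - (1 + s * c)
  -- A primitive of `φ`: the derivative of `ψ c` is c log(1 + sc), and the minus sign in `φ` turns
  -- (a⁻¹ - 1)⁻¹ into (1 - a⁻¹)⁻¹.
  let g : ℝ → ℝ := fun s => K * ((a - 1)⁻¹ * ψ (a - 1) s + (1 - a⁻¹)⁻¹ * ψ (a⁻¹ - 1) s)
  let G : ℝ → ℝ := fun s => (R s * CFC.log (R s)).trace.re - s * ((P - Q) * CFC.log Q).trace.re
  have key := sub_le_sub_of_forall_sub_le (G := G) (g := g) (φ := φ) ?_ ?_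
  · have hR1 : R 1 = P := by simp [R]
    have hR0 : R 0 = Q := by simp [R]
    have hG : G 1 - G 0 = (P * (CFC.log P - CFC.log Q)).trace.re := by
      simp only [G, hR1, hR0, mul_sub, sub_mul, Matrix.trace_sub, Complex.sub_re]
      ring
    have hg : g 1 - g 0 = Real.log a * K := by
      have h1 : a - 1 ≠ 0 := by linarith
      have h2 : 1 - a⁻¹ ≠ 0 := by linarith
      have e1 : 1 + 1 * (a - 1) = a := by ring
      have e2 : 1 + 1 * (a⁻¹ - 1) = a⁻¹ := by ring
      have e3 : (1 - a⁻¹)⁻¹ = a * (a - 1)⁻¹ := by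
        have : 1 - a⁻¹ = (a - 1) * a⁻¹ := by field_simp
        rw [this, mul_inv, inv_inv, mul_comm]
      simp only [g, ψ, e1, e2, e3, Real.log_inv, zero_mul, add_zero, Real.log_one]
      field_simp
      ring
    rw [← hG, ← hg]; exact key
  · intro s t hs hst ht
    have hRs := hR s hs (by linarith)
    have hRt := hR t (by linarith) ht
    -- As the traces agree, Klein bounds the increment of Tr[R log R] by its slope at the right
    -- endpoint t.
    have kl := trace_sub_le_trace_mul_log_sub_log hRs hRt
    have e0 : (R s - R t).trace.re = 0 := by
      rw [hRsub, Matrix.trace_smul, Complex.smul_re, Matrix.trace_sub, Complex.sub_re, htr]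
      simp
    have e1 : (R t * CFC.log (R t)).trace.re - (R s * CFC.log (R t)).trace.re =
        (t - s) * ((P - Q) * CFC.log (R t)).trace.re := by
      rw [← Complex.sub_re, ← Matrix.trace_sub, ← sub_mul, hRsub, smul_mul_assoc,
        Matrix.trace_smul, Complex.smul_re, smul_eq_mul]
    have h3 := hd _ _ _
      (log_smul_one_le_log_sub_log (hpl t (by linarith) ht) hQ (hlow t (by linarith)))
      (log_sub_log_le_log_smul_one (hpu t (by linarith)) hQ hRt (hup t (by linarith)))
    have h4 := mul_le_mul_of_nonneg_left h3 (sub_nonneg.mpr hst.le)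
    rw [e0, mul_sub, Matrix.trace_sub, Complex.sub_re] at kl
    rw [mul_sub, Matrix.trace_sub, Complex.sub_re] at h4
    simp only [G, φ]
    linarith
  · intro s t hs hst ht
    have h1 := mul_log_le_sub_primitive (a - 1) (hpu s hs) (hpu t (by linarith))
    have h2 := mul_log_le_sub_primitive (a⁻¹ - 1) (hpl s hs (by linarith)) (hpl t (by linarith) ht)
    have i1 : 0 < a - 1 := by linarith
    have i2 : 0 < 1 - a⁻¹ := by linarith
    have h1' := mul_le_mul_of_nonneg_left h1 (inv_pos.mpr i1).le
    have h2' := mul_le_mul_of_nonneg_left h2 (inv_pos.mpr i2).le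
    have e1 : (a - 1)⁻¹ * ((t - s) * ((a - 1) * Real.log (1 + s * (a - 1)))) =
        (t - s) * Real.log (1 + s * (a - 1)) := by field_simp
    have e2 : (1 - a⁻¹)⁻¹ * ((t - s) * ((a⁻¹ - 1) * Real.log (1 + s * (a⁻¹ - 1)))) =
        -((t - s) * Real.log (1 + s * (a⁻¹ - 1))) := by
      rw [← neg_sub 1 a⁻¹]
      generalize Real.log _ = l
      calc _ = -((t - s) * l * ((1 - a⁻¹)⁻¹ * (1 - a⁻¹))) := by ring
        _ = _ := by rw [inv_mul_cancel₀ i2.ne', mul_one]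
    rw [e1] at h1'
    rw [e2] at h2'
    have := mul_le_mul_of_nonneg_left (add_le_add h1' h2') hK
    simp only [g, φ, ψ]
    linarith

/-! ### Passage to singular matrices -/

open Filter Topology in
theorem tendsto_trace_mul_log_sub_log {a : ℝ} {P Q : Matrix n n ℂ} (hP : P.PosSemidef)
    (hQ : Q.PosSemidef) (hPQ : P ≤ a • Q) :
    Tendsto (fun δ : ℝ => ((P + δ • (1 : Matrix n n ℂ)) *
        (CFC.log (P + δ • (1 : Matrix n n ℂ)) - CFC.log (Q + δ • (1 : Matrix n n ℂ)))).trace.re)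
      (𝓝[>] 0) (𝓝 (P * (CFC.log P - CFC.log Q)).trace.re) := by
  obtain ⟨w, hw, h, hlog⟩ := exists_weights_trace_mul_log_sub_log hP.isHermitian hQ.isHermitian
  set p := hP.isHermitian.eigenvalues
  set q := hQ.isHermitian.eigenvalues
  have hP' : IsSelfAdjoint P := hP.isHermitian
  have hQ' : IsSelfAdjoint Q := hQ.isHermitian
  -- Absolute continuity of the eigenvalue distributions: compressing `P ≤ a • Q` by the kernel
  -- projection `cfc f Q` of `Q` leaves a nonpositive trace, while all summands are nonnegative.
  have hker (i j : n) (hj : q j = 0) : w i j * p i = 0 := by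
    let f : ℝ → ℝ := fun x => if x = 0 then 1 else 0
    have hf : cfc (fun x : ℝ => x) Q * cfc f Q = 0 := by
      rw [← cfc_mul _ _ Q (continuousOn_spectrum _ _) (continuousOn_spectrum _ _),
        ← cfc_const_zero ℝ Q]
      congr 1; funext x; simp [f]
    rw [cfc_id' ℝ Q] at hf
    have hf0 : 0 ≤ cfc f Q := cfc_nonneg fun x _ => by simp only [f]; split_ifs <;> norm_num
    have h1 : (cfc (fun x : ℝ => x) P * cfc f Q).trace.re ≤ 0 := by
      rw [cfc_id' ℝ P]
      have h2 : 0 ≤ (cfc f Q * (a • Q - P) * cfc f Q).trace := by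
        exact (Matrix.nonneg_iff_posSemidef.mp
          (conjugate_nonneg_of_nonneg (sub_nonneg.mpr hPQ) hf0)).trace_nonneg
      have hff : cfc f Q * cfc f Q = cfc f Q := by
        rw [← cfc_mul _ _ Q (continuousOn_spectrum _ _) (continuousOn_spectrum _ _)]
        congr 1; funext x; simp [f]
      rw [Matrix.trace_mul_comm, ← mul_assoc, hff, Matrix.trace_mul_comm, sub_mul, smul_mul_assoc,
        hf, smul_zero, zero_sub, Matrix.trace_neg] at h2
      have := (Complex.le_def.mp h2).1
      simp only [Complex.zero_re, Complex.neg_re] at this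
      linarith
    rw [h] at h1
    have hnn (i j : n) : 0 ≤ w i j * (p i * f (q j)) :=
      mul_nonneg (hw i j) (mul_nonneg (hP.eigenvalues_nonneg i)
        (by simp only [f]; split_ifs <;> norm_num))
    have h3 := (Finset.sum_eq_zero_iff_of_nonneg fun i _ => Finset.sum_nonneg fun j _ => hnn i j).mp
      (le_antisymm h1 (Finset.sum_nonneg fun i _ => Finset.sum_nonneg fun j _ => hnn i j)) i
      (Finset.mem_univ i)
    have h4 := (Finset.sum_eq_zero_iff_of_nonneg fun j _ => hnn i j).mp h3 j (Finset.mem_univ j)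
    simpa [f, hj] using h4
  have h0 := hlog 0
  simp only [zero_smul, add_zero] at h0
  rw [h0]
  simp only [hlog]
  refine tendsto_finsetSum _ fun i _ => tendsto_finsetSum _ fun j _ => ?_
  by_cases hwij : w i j = 0
  · simp [hwij]
  have hδ : Tendsto (fun δ : ℝ => δ) (𝓝[>] 0) (𝓝 0) := tendsto_id.mono_left nhdsWithin_le_nhds
  by_cases hj : q j = 0
  -- Both logarithms are now log δ and cancel.
  · have hi : p i = 0 := by simpa [hwij] using hker i j hj
    simp [hi, hj]
  · have hp : Tendsto (fun δ : ℝ => p i + δ) (𝓝[>] 0) (𝓝 (p i)) := by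
      simpa using hδ.const_add (p i)
    have hq : Tendsto (fun δ : ℝ => q j + δ) (𝓝[>] 0) (𝓝 (q j)) := by
      simpa using hδ.const_add (q j)
    have h1 := (Real.continuous_mul_log.tendsto (p i)).comp hp
    have h2 := hp.mul ((Real.continuousAt_log hj).tendsto.comp hq)
    simpa only [mul_sub, Function.comp_def] using (h1.sub h2).const_mul (w i j)

/-- An upper bound on the relative entropy of positive semidefinite matrices with bounded ratio. -/
theorem trace_mul_log_sub_log_le {a K : ℝ} (ha : 1 < a) (hK : 0 ≤ K)
    {P Q : Matrix n n ℂ} (hP : P.PosSemidef) (hQ : Q.PosSemidef) (htr : P.trace.re = Q.trace.re)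
    (hPQ : P ≤ a • Q) (hQP : Q ≤ a • P)
    (hd : ∀ (L : Matrix n n ℂ) (c₁ c₂ : ℝ), c₁ • (1 : Matrix n n ℂ) ≤ L →
      L ≤ c₂ • (1 : Matrix n n ℂ) → ((P - Q) * L).trace.re ≤ K * (c₂ - c₁)) :
    (P * (CFC.log P - CFC.log Q)).trace.re ≤ Real.log a * K := by
  refine le_of_tendsto (tendsto_trace_mul_log_sub_log hP hQ hPQ) ?_
  filter_upwards [self_mem_nhdsWithin] with δ hδ
  have hδ : 0 < δ := hδ
  have hone : (δ • (1 : Matrix n n ℂ)).PosDef := Matrix.PosDef.one.smul hδ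
  have hle : δ • (1 : Matrix n n ℂ) ≤ a • (δ • (1 : Matrix n n ℂ)) := by
    have h : 0 ≤ (a - 1) • (δ • (1 : Matrix n n ℂ)) :=
      smul_nonneg (by linarith) hone.posSemidef.nonneg
    rwa [sub_smul, one_smul, sub_nonneg] at h
  refine trace_mul_log_sub_log_le_of_posDef ha hK (hone.posSemidef_add hP) (hone.posSemidef_add hQ)
    ?_ ?_ ?_ ?_
  · simp only [Matrix.trace_add, Complex.add_re, htr]
  · rw [smul_add]; exact add_le_add hPQ hle
  · rw [smul_add]; exact add_le_add hQP hle
  · rwa [add_sub_add_right_eq_sub]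

/-! ### Consequences of privacy -/

theorem QuantumChannel.map_posSemidef (A : QuantumChannel m n) {X : Matrix m m ℂ}
    (hX : X.PosSemidef) : (A X).PosSemidef :=
  Matrix.nonneg_iff_posSemidef.mp (map_nonneg A.toCompletelyPositiveMap hX.nonneg)

/-- Privacy for unnormalized states and effects. -/
theorem IsQLDP.trace_mul_le {ε : ℝ} {A : QuantumChannel m n} (hA : IsQLDP ε A)
    {X Y : Matrix m m ℂ} (hX : X.PosSemidef) (hY : Y.PosSemidef) (hXY : X.trace = Y.trace)
    {M : Matrix n n ℂ} (hM : 0 ≤ M) :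
    (M * A X).trace.re ≤ Real.exp ε * (M * A Y).trace.re := by
  by_cases hT : X.trace = 0
  · have hX0 := hX.trace_eq_zero_iff.mp hT
    have hY0 := hY.trace_eq_zero_iff.mp (hXY ▸ hT)
    simp [hX0, hY0]
  have state {Z : Matrix m m ℂ} (hZ : Z.PosSemidef) (h : X.trace = Z.trace) :
      IsState ((X.trace)⁻¹ • Z) :=
    ⟨hZ.smul (inv_nonneg.mpr hX.trace_nonneg), by
      rw [Matrix.trace_smul, ← h, smul_eq_mul, inv_mul_cancel₀ hT]⟩
  have htr : ((X.trace).re : ℂ) = X.trace :=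
    (Complex.eq_re_of_ofReal_le (r := 0) (by simpa using hX.trace_nonneg)).symm
  have htpos : 0 < X.trace.re :=
    (Complex.pos_iff.mp (lt_of_le_of_ne hX.trace_nonneg (Ne.symm hT))).1
  -- The added 1 keeps `r` invertible when `M = 0`.
  set r : ℝ := ‖M‖ + 1 with hr
  have hr0 : 0 < r := by positivity
  have hMr : r⁻¹ • M ≤ 1 := by
    have h1 : M ≤ algebraMap ℝ _ ‖M‖ :=
      IsSelfAdjoint.le_algebraMap_norm_self (a := M) (Matrix.nonneg_iff_posSemidef.mp hM).isHermitian
    have h2 : M ≤ r • (1 : Matrix n n ℂ) := by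
      refine h1.trans ?_
      rw [Algebra.algebraMap_eq_smul_one, hr, add_smul, one_smul]
      exact le_add_of_nonneg_right zero_le_one
    have h3 := smul_le_smul_of_nonneg_left h2 (inv_nonneg.mpr hr0.le)
    rwa [smul_smul, inv_mul_cancel₀ hr0.ne', one_smul] at h3
  have h := hA _ _ (state hX rfl) (state hY hXY) (r⁻¹ • M) (smul_nonneg (by positivity) hM) hMr
  have e (Z : Matrix m m ℂ) : ((r⁻¹ • M) * A ((X.trace)⁻¹ • Z)).trace.re =
      (r⁻¹ * (X.trace.re)⁻¹) * (M * A Z).trace.re := by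
    rw [← htr, map_smul, smul_mul_assoc, mul_smul_comm, Matrix.trace_smul, Matrix.trace_smul,
      Complex.smul_re, smul_eq_mul, smul_eq_mul, ← Complex.ofReal_inv, Complex.re_ofReal_mul,
      Complex.ofReal_re, mul_assoc]
  rw [e, e, add_zero, mul_left_comm] at h
  exact le_of_mul_le_mul_left h (by positivity)

/-- Rank-one tests vv† recover the quadratic form. -/
theorem le_of_forall_trace_mul_le {k : Type*} [Fintype k] {P Q : Matrix k k ℂ}
    (hP : P.IsHermitian) (hQ : Q.IsHermitian)
    (h : ∀ M : Matrix k k ℂ, 0 ≤ M → (M * P).trace.re ≤ (M * Q).trace.re) : P ≤ Q := by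
  rw [Matrix.le_iff]
  refine Matrix.PosSemidef.of_dotProduct_mulVec_nonneg (hQ.sub hP) fun v => ?_
  rw [Complex.nonneg_iff]
  refine ⟨?_, ((hQ.sub hP).im_star_dotProduct_mulVec_self v).symm⟩
  have h1 := h _ (Matrix.posSemidef_vecMulVec_self_star v).nonneg
  have e (H : Matrix k k ℂ) : (Matrix.vecMulVec v (star v) * H).trace = star v ⬝ᵥ H *ᵥ v := by
    rw [Matrix.vecMulVec_mul, Matrix.trace_vecMulVec, dotProduct_comm, Matrix.dotProduct_mulVec]
  rw [e, e] at h1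
  rw [Matrix.sub_mulVec, dotProduct_sub, Complex.sub_re]
  linarith

theorem IsQLDP.map_le_smul_map {ε : ℝ} {A : QuantumChannel m n} (hA : IsQLDP ε A)
    {X Y : Matrix m m ℂ} (hX : X.PosSemidef) (hY : Y.PosSemidef) (hXY : X.trace = Y.trace) :
    A X ≤ Real.exp ε • A Y := by
  refine le_of_forall_trace_mul_le (A.map_posSemidef hX).isHermitian
    ((A.map_posSemidef hY).smul (Real.exp_pos ε).le).isHermitian fun M hM => ?_
  rw [mul_smul_comm, Matrix.trace_smul, Complex.smul_re, smul_eq_mul]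
  exact hA.trace_mul_le hX hY hXY hM

theorem trace_posPart_eq_traceDistance {ρ σ : Matrix m m ℂ} (hρ : ρ.IsHermitian)
    (hσ : σ.IsHermitian) (h : ρ.trace = σ.trace) :
    (ρ - σ)⁺.trace = (ρ - σ)⁻.trace ∧ (ρ - σ)⁺.trace.re = traceDistance ρ σ := by
  have hB : IsSelfAdjoint (ρ - σ) := hρ.sub hσ
  have h1 : ((ρ - σ)⁺).trace - ((ρ - σ)⁻).trace = 0 := by
    rw [← Matrix.trace_sub, CFC.posPart_sub_negPart (ρ - σ), Matrix.trace_sub, h, sub_self]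
  have h1' := sub_eq_zero.mp h1
  refine ⟨h1', ?_⟩
  have h2 : CFC.sqrt ((ρ - σ)ᴴ * (ρ - σ)) = (ρ - σ)⁺ + (ρ - σ)⁻ :=
    (CFC.posPart_add_negPart (ρ - σ)).symm
  rw [traceDistance, traceNorm, h2, Matrix.trace_add, ← h1', Complex.add_re]
  ring

/-- The contraction of the trace distance, tested against an observable with bounded spectrum. -/
theorem IsQLDP.trace_sub_mul_le {ε : ℝ} {A : QuantumChannel m n} (hA : IsQLDP ε A)
    {ρ σ : Matrix m m ℂ} (hρ : ρ.IsHermitian) (hσ : σ.IsHermitian) (h : ρ.trace = σ.trace)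
    {L : Matrix n n ℂ} {c₁ c₂ : ℝ} (h₁ : c₁ • (1 : Matrix n n ℂ) ≤ L)
    (h₂ : L ≤ c₂ • (1 : Matrix n n ℂ)) :
    ((A ρ - A σ) * L).trace.re ≤
      (Real.exp ε - 1) / (Real.exp ε + 1) * traceDistance ρ σ * (c₂ - c₁) := by
  obtain ⟨htr, hT⟩ := trace_posPart_eq_traceDistance hρ hσ h
  have hB : IsSelfAdjoint (ρ - σ) := hρ.sub hσ
  have hX : ((ρ - σ)⁺).PosSemidef :=
    Matrix.nonneg_iff_posSemidef.mp (CFC.posPart_nonneg (ρ - σ))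
  have hY : ((ρ - σ)⁻).PosSemidef :=
    Matrix.nonneg_iff_posSemidef.mp (CFC.negPart_nonneg (ρ - σ))
  have hXY : A ρ - A σ = A (ρ - σ)⁺ - A (ρ - σ)⁻ := by
    rw [← map_sub, ← map_sub, CFC.posPart_sub_negPart (ρ - σ)]
  have tX := A.trace_map (ρ - σ)⁺
  have tY := A.trace_map (ρ - σ)⁻
  rw [hXY]
  -- Using the effects L - c₁ and c₂ - L with the two parts in opposite roles, the sum of the bounds
  -- gives (a + 1)Tr[(P - Q)L] ≤ (a - 1)T(c₂ - c₁).
  have k1 := hA.trace_mul_le hX hY htr (sub_nonneg.mpr h₁)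
  have k2 := hA.trace_mul_le hY hX htr.symm (sub_nonneg.mpr h₂)
  simp only [sub_mul, smul_mul_assoc, one_mul, Matrix.trace_sub, Matrix.trace_smul, tX, tY, ← htr,
    Complex.sub_re, Complex.smul_re, smul_eq_mul, hT] at k1 k2
  rw [Matrix.trace_mul_comm, mul_sub, Matrix.trace_sub, Complex.sub_re, div_mul_eq_mul_div,
    div_mul_eq_mul_div, le_div_iff₀ (by positivity)]
  linarith

theorem supp_le_supp {a : ℝ} {P Q : Matrix n n ℂ} (hP : P.PosSemidef) (hPQ : P ≤ a • Q) :
    supp P ≤ supp Q := by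
  refine Submodule.orthogonal_le fun x hx => ?_
  rw [LinearMap.mem_ker] at hx ⊢
  have hQx : Q *ᵥ x.ofLp = 0 := by
    simpa [Matrix.toLpLin_apply] using hx
  have h1 := (Matrix.le_iff.mp hPQ).dotProduct_mulVec_nonneg x.ofLp
  rw [Matrix.sub_mulVec, Matrix.smul_mulVec, hQx, smul_zero, zero_sub, dotProduct_neg,
    neg_nonneg] at h1
  have h2 := (hP.dotProduct_mulVec_zero_iff x.ofLp).mp
    (le_antisymm h1 (hP.dotProduct_mulVec_nonneg x.ofLp))
  simp [Matrix.toLpLin_apply, h2]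

theorem traceDistance_nonneg (ρ σ : Matrix n n ℂ) : 0 ≤ traceDistance ρ σ :=
  mul_nonneg (by norm_num) (Complex.nonneg_iff.mp
    (Matrix.nonneg_iff_posSemidef.mp (CFC.sqrt_nonneg _)).trace_nonneg).1

end QuantumPrivacy

theorem mainTheorem5 {m n : Type*} [Fintype m] [DecidableEq m] [Fintype n] [DecidableEq n]
    (ε : ℝ) (hε : 0 ≤ ε) (A : QuantumPrivacy.QuantumChannel m n)
    (hA : QuantumPrivacy.IsQLDP ε A) (ρ σ : Matrix m m ℂ)
    (hρ : QuantumPrivacy.IsState ρ) (hσ : QuantumPrivacy.IsState σ) :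
    QuantumPrivacy.relativeEntropy (A ρ) (A σ) ≤
      ((ε * ((Real.exp ε - 1) / (Real.exp ε + 1)) * QuantumPrivacy.traceDistance ρ σ : ℝ) :
        EReal) := by
  have hP := A.map_posSemidef hρ.posSemidef
  have hQ := A.map_posSemidef hσ.posSemidef
  have htr : ρ.trace = σ.trace := hρ.trace_eq_one.trans hσ.trace_eq_one.symm
  have hPQ := hA.map_le_smul_map hρ.posSemidef hσ.posSemidef htr
  have hQP := hA.map_le_smul_map hσ.posSemidef hρ.posSemidef htr.symm
  rw [QuantumPrivacy.relativeEntropy, if_pos (QuantumPrivacy.supp_le_supp hP hPQ),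
    EReal.coe_le_coe_iff]
  -- The integral bound divides by a - 1; at ε = 0 the two outputs coincide.
  rcases hε.eq_or_lt with rfl | hε
  · rw [Real.exp_zero, one_smul] at hPQ hQP
    simp [le_antisymm hPQ hQP]
  · have ha : 1 < Real.exp ε := Real.one_lt_exp_iff.mpr hε
    have hK : 0 ≤ (Real.exp ε - 1) / (Real.exp ε + 1) * QuantumPrivacy.traceDistance ρ σ :=
      mul_nonneg (div_nonneg (by linarith) (by positivity))
        (QuantumPrivacy.traceDistance_nonneg ρ σ)
    have h := QuantumPrivacy.trace_mul_log_sub_log_le ha hK hP hQ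
      (by rw [A.trace_map, A.trace_map, htr]) hPQ hQP fun L c₁ c₂ h₁ h₂ =>
        hA.trace_sub_mul_le hρ.posSemidef.isHermitian hσ.posSemidef.isHermitian htr h₁ h₂
    rwa [Real.log_exp, ← mul_assoc] at h
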